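/- Let $(\Omega,\mathcal F)$ be a measurable space, $T:\Omega\to\Omega$ measurable, and let $\mathcal B_b(\Omega)$ be the space of bounded $\mathcal F$-measurable real functions. For a functional $\mathbb E:\mathcal B_b(\Omega)\to\mathbb R$ let $\Theta(\mathbb E)$ be the set of all probabilities $P$ on $(\Omega,\mathcal F)$ with $\mathrm E_P[f]\le\mathbb E[f]$ for all $f\in\mathcal B_b(\Omega)$, and let $\mathbb V_{\mathbb E}(A)=\sup_{P\in\Theta(\mathbb E)}P(A)$ for $A\in\mathcal F$. Call $\mathbb E$ a continuous $T$-invariant sublinear expectation (continuous ISE) if $\mathbb E[f]=\sup_{P\in\Theta(\mathbb E)}\mathrm E_P[f]$ and $\mathbb E[f\circ T]=\mathbb E[f]$ for all $f\in\mathcal B_b(\Omega)$, and $\mathbb V_{\mathbb E}(A_n)\to0$ whenever $A_n\in\mathcal F$, $A_n\downarrow\emptyset$. A continuous ISE $\mathbb E$ has a finite period if there is an integer $p\ge1$ with $\mathbb E[f\circ T^p-f]=0$ for all $f\in\mathcal B_b(\Omega)$; the smallest such $p$ is its period $p_{\mathbb E}$. A continuous ISE $\mathbb E$ with finite period is strongly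 $T$-ergodic if $\mathbb V_{\mathbb E}(A)\in\{0,1\}$ for every $A\in\mathcal F$ with $(T^{p_{\mathbb E}})^{-1}A=A$. Proposition. Let $\mathbb E$ be a continuous ISE on $\mathcal B_b(\Omega)$ with finite period. For every integer $d\ge1$ the limit $$\mathbb E^{(d)}[f]=\lim_{n\to\infty}\frac1n\,\mathbb E\Big[\sum_{k=0}^{n-1}f\circ T^{kd}\Big],\qquad f\in\mathcal B_b(\Omega),$$ exists, and $\mathbb E^{(d)}$ is again a continuous ISE with finite period; write $p_d$ for its period and $\Theta^{(d)}=\Theta(\mathbb E^{(d)})$. Then $\mathbb E$ is strongly $T$-ergodic if and only if $\mathbb E^{(d)}$ is strongly $T$-ergodic for every $d\ge1$. In this case, for every $d\ge1$, $\Theta^{(d)}$ is the convex hull of a finite set of $T^{p_d}$-ergodic probabilities (a probability $P$ is $T^{p_d}$-ergodic if it is $T^{p_d}$-invariant and $P(A)\in\{0,1\}$ for every $A\in\mathcal F$ with $(T^{p_d})^{-1}A=A$). -/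

import Mathlib

open MeasureTheory Filter Topology
open scoped NNReal ENNReal

namespace SublinExp

/-- The vector space of bounded measurable real functions on `Ω`. -/
def Bb (Ω : Type*) [MeasurableSpace Ω] : Submodule ℝ (Ω → ℝ) where
  carrier := {f | Measurable f ∧ ∃ C : ℝ, ∀ ω, |f ω| ≤ C}
  add_mem' := by
    rintro f g ⟨hf, C, hC⟩ ⟨hg, D, hD⟩
    exact ⟨hf.add hg, C + D, fun ω => (abs_add_le _ _).trans (add_le_add (hC ω) (hD ω))⟩
  zero_mem' := ⟨measurable_const, 0, fun ω => by simp⟩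
  smul_mem' := by
    rintro c f ⟨hf, C, hC⟩
    refine ⟨hf.const_smul c, |c| * C, fun ω => ?_⟩
    simp only [Pi.smul_apply, smul_eq_mul, abs_mul]
    exact mul_le_mul_of_nonneg_left (hC ω) (abs_nonneg c)

/-- The bounded measurable function `f ∘ S`, for measurable `S`. -/
def Bb.comp {Ω : Type*} [MeasurableSpace Ω] (f : Bb Ω) {S : Ω → Ω} (hS : Measurable S) : Bb Ω :=
  ⟨fun ω => f.1 (S ω), f.2.1.comp hS, f.2.2.imp fun _ hC ω => hC (S ω)⟩

/-- `Θ`: the set of all probability measures dominated by the functional `E`. -/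
def dominated {Ω : Type*} [MeasurableSpace Ω] (E : Bb Ω → ℝ) : Set (Measure Ω) :=
  {P | IsProbabilityMeasure P ∧ ∀ f : Bb Ω, ∫ ω, f.1 ω ∂P ≤ E f}

/-- `E` is a sublinear expectation on the bounded measurable functions: `E[f] = sup_{P ∈ Θ} E_P[f]`,
where `Θ` is the set of all probability measures dominated by `E`.
(The set over which the supremum is taken is nonempty, since the empty set has no
least upper bound in `ℝ`.) -/
def IsSublinearExpectation {Ω : Type*} [MeasurableSpace Ω] (E : Bb Ω → ℝ) : Prop :=
  ∀ f : Bb Ω, IsLUB ((fun P : Measure Ω => ∫ ω, f.1 ω ∂P) '' dominated E) (E f)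

/-- The upper probability `V(A) = sup_{P ∈ Θ} P(A)` associated with `E`. -/
noncomputable def upperProb {Ω : Type*} [MeasurableSpace Ω] (E : Bb Ω → ℝ) (A : Set Ω) : ℝ≥0∞ :=
  ⨆ P ∈ dominated E, P A

/-- `E` is continuous: `V(Aₙ) → 0` whenever the measurable sets `Aₙ` decrease to `∅`. -/
def IsContinuous {Ω : Type*} [MeasurableSpace Ω] (E : Bb Ω → ℝ) : Prop :=
  ∀ A : ℕ → Set Ω, (∀ n, MeasurableSet (A n)) → Antitone A → ⋂ n, A n = ∅ →
    Tendsto (fun n => upperProb E (A n)) atTop (𝓝 0)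

/-- `E` is `T`-invariant: `E[f ∘ T] = E[f]`. -/
def IsInvariant {Ω : Type*} [MeasurableSpace Ω] {T : Ω → Ω} (hT : Measurable T)
    (E : Bb Ω → ℝ) : Prop :=
  ∀ f : Bb Ω, E (Bb.comp f hT) = E f

/-- `E` is a continuous `T`-invariant sublinear expectation on the bounded measurable functions. -/
structure IsContinuousISE {Ω : Type*} [MeasurableSpace Ω] {T : Ω → Ω} (hT : Measurable T)
    (E : Bb Ω → ℝ) : Prop where
  sublinear : IsSublinearExpectation E
  continuous : IsContinuous E
  invariant : IsInvariant hT E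

/-- The positive integers `p` with `E[f ∘ T^p - f] = 0` for every `f`. -/
def periods {Ω : Type*} [MeasurableSpace Ω] {T : Ω → Ω} (hT : Measurable T)
    (E : Bb Ω → ℝ) : Set ℕ :=
  {p | 0 < p ∧ ∀ f : Bb Ω, E (Bb.comp f (hT.iterate p) - f) = 0}

/-- `E` is periodic (has a finite period). -/
def IsPeriodic {Ω : Type*} [MeasurableSpace Ω] {T : Ω → Ω} (hT : Measurable T)
    (E : Bb Ω → ℝ) : Prop :=
  (periods hT E).Nonempty

/-- The period of a periodic `E`: the smallest element of `periods hT E`. -/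
noncomputable def period {Ω : Type*} [MeasurableSpace Ω] {T : Ω → Ω} (hT : Measurable T)
    (E : Bb Ω → ℝ) : ℕ :=
  sInf (periods hT E)

/-- `E` is strongly `T`-ergodic: it is a continuous `T`-invariant sublinear expectation with finite
period `p`, and `V(A) ∈ {0, 1}` for every `A` in the `T^p`-invariant σ-algebra. -/
structure IsStronglyErgodic {Ω : Type*} [MeasurableSpace Ω] {T : Ω → Ω} (hT : Measurable T)
    (E : Bb Ω → ℝ) : Prop where
  continuousISE : IsContinuousISE hT E
  periodic : IsPeriodic hT E
  trivial_on_invariants : ∀ A : Set Ω,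
    MeasurableSet[MeasurableSpace.invariants (T^[period hT E])] A →
      upperProb E A = 0 ∨ upperProb E A = 1

/-- The averages `(1/n) E[∑_{k<n} f ∘ T^{kd}]`. -/
noncomputable def average {Ω : Type*} [MeasurableSpace Ω] {T : Ω → Ω} (hT : Measurable T)
    (E : Bb Ω → ℝ) (d : ℕ) (f : Bb Ω) (n : ℕ) : ℝ :=
  (1 / (n : ℝ)) * E (∑ k ∈ Finset.range n, Bb.comp f (hT.iterate (k * d)))

/-- The component `E^{(d)}[f] = lim_n (1/n) E[∑_{k<n} f ∘ T^{kd}]`. -/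
noncomputable def component {Ω : Type*} [MeasurableSpace Ω] {T : Ω → Ω} (hT : Measurable T)
    (E : Bb Ω → ℝ) (d : ℕ) (f : Bb Ω) : ℝ :=
  limUnder atTop (average hT E d f)

end SublinExp

namespace SublinExp

/-! Everything is read off from the set `dominated E`. A number p is a period iff `T^[p]` preserves
every dominated probability (`mem_periods_iff`). So along each such measure the integrals of f ∘
T^(kd) are p-periodic in k, and the limit defining the component is already the average over k < p
(`component_eq_average`). Dually, Θ^(d) is the set of `T^[d]`-invariant elements of Θ
(`mem_dominated_component_iff`), and the upper probabilities of E and its component agree on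
`T^[d]`-invariant sets (`upperProb_component`). Since p_d divides both d and the period of E, the
zero-one law descends to components; conversely, E is its own component at d = p.

For the convex hull, continuity makes splitting Ω into invariant pieces of upper probability one
terminate (`IsContinuous.wellFounded`), leaving finitely many atoms. On an atom all dominated
probabilities have the same conditional law, which is ergodic and itself dominated. -/

variable {Ω : Type*} [MeasurableSpace Ω] {T : Ω → Ω} {E : Bb Ω → ℝ}

/-! ### Integrals of bounded functions and measure preservation. -/

theorem Bb.integrable (f : Bb Ω) (P : Measure Ω) [IsFiniteMeasure P] : Integrable f.1 P := by
  obtain ⟨C, hC⟩ := f.2.2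
  exact .of_bound f.2.1.aestronglyMeasurable C (ae_of_all _ hC)

theorem Bb.integral_comp (f : Bb Ω) {S : Ω → Ω} (hS : Measurable S) (P : Measure Ω) :
    ∫ ω, (Bb.comp f hS).1 ω ∂P = ∫ ω, f.1 ω ∂(P.map S) :=
  (integral_map hS.aemeasurable f.2.1.aestronglyMeasurable).symm

theorem Bb.integral_sum {ι : Type*} (s : Finset ι) (f : ι → Bb Ω) (P : Measure Ω)
    [IsFiniteMeasure P] :
    ∫ ω, (∑ i ∈ s, f i).1 ω ∂P = ∑ i ∈ s, ∫ ω, (f i).1 ω ∂P := by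
  rw [← integral_finsetSum _ fun i _ => Bb.integrable (f i) P]
  congr 1 with ω
  simp

theorem Bb.integral_sub (f g : Bb Ω) (P : Measure Ω) [IsFiniteMeasure P] :
    ∫ ω, (f - g).1 ω ∂P = ∫ ω, f.1 ω ∂P - ∫ ω, g.1 ω ∂P :=
  MeasureTheory.integral_sub (Bb.integrable f P) (Bb.integrable g P)

theorem Bb.integral_neg (f : Bb Ω) (P : Measure Ω) :
    ∫ ω, (-f).1 ω ∂P = -∫ ω, f.1 ω ∂P :=
  MeasureTheory.integral_neg _

theorem Bb.abs_integral_le (f : Bb Ω) {C : ℝ} (hC : ∀ ω, |f.1 ω| ≤ C) (P : Measure Ω)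
    [IsProbabilityMeasure P] : |∫ ω, f.1 ω ∂P| ≤ C := by
  have h : ∀ᵐ ω ∂P, ‖f.1 ω‖ ≤ C := ae_of_all _ hC
  simpa using norm_integral_le_of_norm_le_const h

/-- A finite measure is preserved as soon as integrals of bounded functions are. -/
theorem measurePreserving_of_integral {S : Ω → Ω} (hS : Measurable S) {P : Measure Ω}
    [IsFiniteMeasure P] (h : ∀ f : Bb Ω, ∫ ω, (Bb.comp f hS).1 ω ∂P = ∫ ω, f.1 ω ∂P) :
    MeasurePreserving S P P := by
  refine ⟨hS, Measure.ext fun A hA => ?_⟩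
  have := h ⟨A.indicator 1, measurable_one.indicator hA, 1, fun ω => by
    by_cases hω : ω ∈ A <;> simp [hω]⟩
  rw [Bb.integral_comp] at this
  simp only [integral_indicator_one hA, Measure.real] at this
  exact (ENNReal.toReal_eq_toReal_iff' (measure_ne_top _ _) (measure_ne_top _ _)).1 this

/-- Applying the inequality to f and to -f turns it into an equality. -/
theorem measurePreserving_of_integral_sub_nonpos {S : Ω → Ω} (hS : Measurable S) {P : Measure Ω}
    [IsFiniteMeasure P] (h : ∀ f : Bb Ω, ∫ ω, (Bb.comp f hS - f).1 ω ∂P ≤ 0) :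
    MeasurePreserving S P P := by
  refine measurePreserving_of_integral hS fun f => ?_
  have h1 := h f
  have h2 := h (-f)
  have h3 : Bb.comp (-f) hS - -f = -(Bb.comp f hS - f) := by
    ext ω
    simp [Bb.comp]
    ring
  rw [h3, Bb.integral_neg] at h2
  rw [Bb.integral_sub] at h1 h2
  linarith

theorem _root_.MeasureTheory.MeasurePreserving.integral_Bb {S : Ω → Ω} {P : Measure Ω}
    (h : MeasurePreserving S P P) (f : Bb Ω) :
    ∫ ω, (Bb.comp f h.measurable).1 ω ∂P = ∫ ω, f.1 ω ∂P := by
  rw [Bb.integral_comp, h.map_eq]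

/-! ### Dominated probabilities, periods and upper probability. -/

theorem IsSublinearExpectation.nonempty (h : IsSublinearExpectation E) :
    (dominated E).Nonempty := by
  by_contra hne
  rw [Set.not_nonempty_iff_eq_empty] at hne
  have := h 0
  rw [hne, Set.image_empty, isLUB_empty_iff] at this
  exact not_isBot _ this

theorem IsSublinearExpectation.le_of_forall (h : IsSublinearExpectation E) {f : Bb Ω} {c : ℝ}
    (hc : ∀ P ∈ dominated E, ∫ ω, f.1 ω ∂P ≤ c) : E f ≤ c :=
  (h f).2 (by rintro _ ⟨P, hP, rfl⟩; exact hc P hP)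

theorem IsSublinearExpectation.eq_of_forall (h : IsSublinearExpectation E) {f : Bb Ω} {c : ℝ}
    (hc : ∀ P ∈ dominated E, ∫ ω, f.1 ω ∂P = c) : E f = c := by
  obtain ⟨P, hP⟩ := h.nonempty
  exact le_antisymm (h.le_of_forall fun Q hQ => (hc Q hQ).le) (hc P hP ▸ hP.2 f)

/-- `p` is a period iff `T^p` preserves every dominated probability. -/
theorem mem_periods_iff (hT : Measurable T) (h : IsSublinearExpectation E) {p : ℕ} :
    p ∈ periods hT E ↔ 0 < p ∧ ∀ P ∈ dominated E, MeasurePreserving T^[p] P P := by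
  refine and_congr_right fun _ => ⟨fun hp P hP => ?_, fun hp f => ?_⟩
  · have := hP.1
    exact measurePreserving_of_integral_sub_nonpos (hT.iterate p) fun f => hp f ▸ hP.2 _
  · refine h.eq_of_forall fun P hP => ?_
    have := hP.1
    rw [Bb.integral_sub, (hp P hP).integral_Bb, sub_self]

/-- If `T^a` and `T^b` preserve `P`, so does `T^(a mod b)`. -/
theorem measurePreserving_iterate_mod (hT : Measurable T) {P : Measure Ω} {a b : ℕ}
    (ha : MeasurePreserving T^[a] P P) (hb : MeasurePreserving T^[b] P P) :
    MeasurePreserving T^[a % b] P P := by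
  refine ⟨hT.iterate _, ?_⟩
  have h := hb.iterate (a / b)
  rw [← Function.iterate_mul] at h
  conv_lhs => rw [← h.map_eq]
  rw [Measure.map_map (hT.iterate _) h.measurable, ← Function.iterate_add, Nat.mod_add_div,
    ha.map_eq]

theorem period_mem {hT : Measurable T} (hper : IsPeriodic hT E) :
    period hT E ∈ periods hT E :=
  Nat.sInf_mem hper

/-- A nonzero remainder of p modulo the period would be a smaller period. -/
theorem period_dvd {hT : Measurable T} (h : IsSublinearExpectation E) {p : ℕ}
    (hp : p ∈ periods hT E) : period hT E ∣ p := by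
  have hq := period_mem ⟨p, hp⟩
  rw [Nat.dvd_iff_mod_eq_zero]
  by_contra hne
  refine (Nat.mod_lt p hq.1).not_ge (Nat.sInf_le (m := p % period hT E) ?_)
  rw [mem_periods_iff hT h] at hp hq ⊢
  exact ⟨Nat.pos_of_ne_zero hne, fun P hP =>
    measurePreserving_iterate_mod hT (hp.2 P hP) (hq.2 P hP)⟩

theorem measure_le_upperProb {P : Measure Ω} (hP : P ∈ dominated E) (A : Set Ω) :
    P A ≤ upperProb E A :=
  le_iSup₂ (f := fun P (_ : P ∈ dominated E) => P A) P hP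

theorem measure_eq_zero_of_upperProb {P : Measure Ω} (hP : P ∈ dominated E) {A : Set Ω}
    (hA : upperProb E A = 0) : P A = 0 :=
  le_antisymm (hA ▸ measure_le_upperProb hP A) (zero_le)

theorem upperProb_mono {A B : Set Ω} (h : A ⊆ B) : upperProb E A ≤ upperProb E B :=
  iSup₂_mono fun _ _ => measure_mono h

/-! ### Averaging along `T^d` -/

/-- Partial sums of a `p`-periodic sequence grow linearly, up to a bounded error. -/
theorem abs_mul_sum_range_sub_le {a : ℕ → ℝ} {p : ℕ} (hp : 0 < p) (ha : a.Periodic p) {C : ℝ}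
    (hC : ∀ k, |a k| ≤ C) (n : ℕ) :
    |p * ∑ k ∈ Finset.range n, a k - n * ∑ k ∈ Finset.range p, a k| ≤ 2 * p * p * C := by
  have hC0 : 0 ≤ C := (abs_nonneg _).trans (hC 0)
  have hadd : ∀ n, ∑ k ∈ Finset.range (n + p), a k
      = ∑ k ∈ Finset.range n, a k + ∑ k ∈ Finset.range p, a k := by
    intro n
    induction n with
    | zero => simp
    | succ n ih =>
      rw [Nat.add_right_comm, Finset.sum_range_succ, ih, Finset.sum_range_succ, ha n]
      ring
  have hbound : ∀ n, |∑ k ∈ Finset.range n, a k| ≤ n * C := fun n =>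
    (Finset.abs_sum_le_sum_abs _ _).trans ((Finset.sum_le_sum fun k _ => hC k).trans (by simp))
  -- The error itself is p-periodic in n, so n may be replaced by n % p ≤ p; each of its two terms
  -- is then at most p * p * C.
  have hG : Function.Periodic
      (fun n : ℕ => (p : ℝ) * ∑ k ∈ Finset.range n, a k - n * ∑ k ∈ Finset.range p, a k) p := by
    intro n
    simp only [hadd, Nat.cast_add]
    ring
  rw [← hG.map_mod_nat n]
  have hlt : ((n % p : ℕ) : ℝ) ≤ p := by exact_mod_cast (Nat.mod_lt n hp).le
  refine (abs_sub _ _).trans ?_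
  rw [abs_mul, abs_mul, Nat.abs_cast, Nat.abs_cast]
  have h1 := mul_le_mul_of_nonneg_left ((hbound (n % p)).trans
    (mul_le_mul_of_nonneg_right hlt hC0)) (Nat.cast_nonneg (α := ℝ) p)
  have h2 := mul_le_mul hlt (hbound p) (abs_nonneg _) (Nat.cast_nonneg _)
  linarith

variable (hT : Measurable T)

theorem integral_birkhoffSum (f : Bb Ω) (d n : ℕ) (P : Measure Ω) [IsFiniteMeasure P] :
    ∫ ω, (∑ k ∈ Finset.range n, Bb.comp f (hT.iterate (k * d))).1 ω ∂P
      = ∑ k ∈ Finset.range n, ∫ ω, f.1 ω ∂(P.map T^[k * d]) := by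
  simp only [Bb.integral_sum, Bb.integral_comp]

/-- The linear-growth estimate is uniform over dominated measures, so it survives the supremum
defining E; dividing by n * p leaves an error of at most 2pC / n. -/
theorem tendsto_average (h : IsSublinearExpectation E) {p : ℕ} (hp : p ∈ periods hT E) (d : ℕ)
    (f : Bb Ω) : Tendsto (average hT E d f) atTop (𝓝 (average hT E d f p)) := by
  obtain ⟨hp0, hpres⟩ := (mem_periods_iff hT h).1 hp
  have hp0' : (0 : ℝ) < p := by exact_mod_cast hp0
  obtain ⟨C, hC⟩ := f.2.2
  set S : ℕ → Bb Ω := fun n => ∑ k ∈ Finset.range n, Bb.comp f (hT.iterate (k * d)) with hS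
  have key : ∀ P ∈ dominated E, ∀ n : ℕ,
      |p * ∫ ω, (S n).1 ω ∂P - n * ∫ ω, (S p).1 ω ∂P| ≤ 2 * p * p * C := by
    intro P hP n
    have := hP.1
    simp only [hS, integral_birkhoffSum hT]
    refine abs_mul_sum_range_sub_le hp0 (fun k => ?_) (fun k => ?_) n
    · have hd := (hpres P hP).iterate d
      rw [← Function.iterate_mul] at hd
      rw [add_mul, Function.iterate_add, ← Measure.map_map (hT.iterate _) (hT.iterate _),
        hd.map_eq]
    · have := Measure.isProbabilityMeasure_map (μ := P) (hT.iterate (k * d)).aemeasurable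
      exact Bb.abs_integral_le f hC _
  have hkey : ∀ n : ℕ, |p * E (S n) - n * E (S p)| ≤ 2 * p * p * C := by
    intro n
    rw [abs_le]
    constructor
    -- The lower bound comes from bounding E (S p) after division by n, so n = 0 is treated apart.
    · rcases n.eq_zero_or_pos with rfl | hn
      · have h0 : E (S 0) = 0 := h.eq_of_forall fun P _ => by simp [hS]
        obtain ⟨P, hP⟩ := h.nonempty
        have := (abs_nonneg _).trans (key P hP 0)
        simp only [h0]
        simpa using this
      have hn' : (0 : ℝ) < n := by exact_mod_cast hn
      have : E (S p) ≤ (p * E (S n) + 2 * p * p * C) / n := by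
        refine h.le_of_forall fun P hP => ?_
        rw [le_div_iff₀ hn']
        have h1 := (abs_le.1 (key P hP n)).1
        have h2 := mul_le_mul_of_nonneg_left (hP.2 (S n)) hp0'.le
        linarith
      rw [le_div_iff₀ hn'] at this
      linarith
    · have : E (S n) ≤ (n * E (S p) + 2 * p * p * C) / p := by
        refine h.le_of_forall fun P hP => ?_
        rw [le_div_iff₀ hp0']
        have h1 := (abs_le.1 (key P hP n)).2
        have h2 := mul_le_mul_of_nonneg_left (hP.2 (S p)) (Nat.cast_nonneg (α := ℝ) n)
        linarith
      rw [le_div_iff₀ hp0'] at this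
      linarith
  rw [tendsto_iff_norm_sub_tendsto_zero]
  refine squeeze_zero' (.of_forall fun _ => norm_nonneg _) ?_
    (tendsto_const_div_atTop_nhds_zero_nat (2 * p * C))
  filter_upwards [eventually_gt_atTop 0] with n hn
  have hn' : (0 : ℝ) < n := by exact_mod_cast hn
  have e : average hT E d f n - average hT E d f p = (p * E (S n) - n * E (S p)) / (n * p) := by
    simp only [average, hS]
    field_simp
  rw [e, Real.norm_eq_abs, abs_div, abs_of_pos (mul_pos hn' hp0'), div_le_div_iff₀ (by positivity)
    hn']
  have := mul_le_mul_of_nonneg_right (hkey n) hn'.le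
  linarith

theorem component_eq_average (h : IsSublinearExpectation E) {p : ℕ} (hp : p ∈ periods hT E)
    (d : ℕ) (f : Bb Ω) : component hT E d f = average hT E d f p :=
  (tendsto_average hT h hp d f).limUnder_eq

/-- The average of the images of `P` under `T^(k d)`, `k < p`. -/
noncomputable def averageMeasure (T : Ω → Ω) (d p : ℕ) (P : Measure Ω) : Measure Ω :=
  (p : ℝ≥0∞)⁻¹ • ∑ k ∈ Finset.range p, P.map T^[k * d]

theorem averageMeasure_eq_of_forall {d p : ℕ} (hp : 0 < p) {P : Measure Ω} {A : Set Ω}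
    {c : ℝ≥0∞} (h : ∀ k, P.map T^[k * d] A = c) : averageMeasure T d p P A = c := by
  simp only [averageMeasure, Measure.smul_apply, Measure.finsetSum_apply, h, Finset.sum_const,
    Finset.card_range, nsmul_eq_mul, smul_eq_mul, ← mul_assoc]
  rw [ENNReal.inv_mul_cancel (by exact_mod_cast hp.ne') (by simp), one_mul]

theorem isProbabilityMeasure_averageMeasure {T : Ω → Ω} (hT : Measurable T) {d p : ℕ} (hp : 0 < p) (P : Measure Ω)
    [IsProbabilityMeasure P] : IsProbabilityMeasure (averageMeasure T d p P) :=
  ⟨averageMeasure_eq_of_forall hp fun k => by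
    rw [Measure.map_apply (hT.iterate _) .univ, Set.preimage_univ, measure_univ]⟩

theorem integral_averageMeasure (f : Bb Ω) (d p : ℕ) (P : Measure Ω) [IsProbabilityMeasure P] :
    ∫ ω, f.1 ω ∂(averageMeasure T d p P)
      = 1 / p * ∫ ω, (∑ k ∈ Finset.range p, Bb.comp f (hT.iterate (k * d))).1 ω ∂P := by
  rw [averageMeasure, integral_smul_measure, integral_birkhoffSum hT,
    integral_finsetSum_measure fun k _ => Bb.integrable f _]
  simp

/-- Integrating against the averaged measure is the dual of the finite formula for the component. -/
theorem averageMeasure_mem_dominated (h : IsSublinearExpectation E) {p : ℕ}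
    (hp : p ∈ periods hT E) (d : ℕ) {P : Measure Ω} (hP : P ∈ dominated E) :
    averageMeasure T d p P ∈ dominated (component hT E d) := by
  have := hP.1
  refine ⟨isProbabilityMeasure_averageMeasure hT hp.1 P, fun f => ?_⟩
  rw [integral_averageMeasure hT, component_eq_average hT h hp]
  exact mul_le_mul_of_nonneg_left (hP.2 _) (by positivity)

theorem IsInvariant.iterate {hT : Measurable T} (h : IsInvariant hT E) (n : ℕ) (f : Bb Ω) :
    E (Bb.comp f (hT.iterate n)) = E f := by
  induction n with
  | zero => rfl
  | succ n ih => rw [← ih, ← h (Bb.comp f (hT.iterate n))]; rfl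

/-- `Θ^(d)` consists of the `T^d`-invariant elements of `Θ`. -/
theorem mem_dominated_component_iff (hE : IsContinuousISE hT E) {p : ℕ} (hp : p ∈ periods hT E)
    {d : ℕ} {P : Measure Ω} :
    P ∈ dominated (component hT E d) ↔ P ∈ dominated E ∧ MeasurePreserving T^[d] P P := by
  have h := hE.sublinear
  have hp0 : (0 : ℝ) < p := by exact_mod_cast hp.1
  constructor
  · intro hP
    have := hP.1
    refine ⟨⟨this, fun f => (hP.2 f).trans ?_⟩,
      measurePreserving_of_integral_sub_nonpos (hT.iterate d) fun f => (hP.2 _).trans ?_⟩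
    · rw [component_eq_average hT h hp, average, one_div, inv_mul_le_iff₀ hp0]
      refine h.le_of_forall fun Q hQ => ?_
      have := hQ.1
      rw [Bb.integral_sum]
      -- Invariance of E bounds each of the p summands by E f, which cancels the factor 1 / p.
      refine (Finset.sum_le_sum fun k _ =>
        (hQ.2 _).trans_eq (hE.invariant.iterate (k * d) f)).trans (by simp)
    · rw [component_eq_average hT h hp, average]
      refine (mul_eq_zero_of_right _ (h.eq_of_forall fun Q hQ => ?_)).le
      have := hQ.1
      rw [integral_birkhoffSum hT]
      simp only [← Bb.integral_comp _ (hT.iterate _)]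
      have e : ∀ k, ∫ ω, (Bb.comp (Bb.comp f (hT.iterate d) - f) (hT.iterate (k * d))).1 ω ∂Q
          = ∫ ω, (Bb.comp f (hT.iterate ((k + 1) * d))).1 ω ∂Q
            - ∫ ω, (Bb.comp f (hT.iterate (k * d))).1 ω ∂Q := by
        intro k
        rw [← Bb.integral_sub]
        congr 1 with ω
        simp [Bb.comp, add_mul, add_comm (k * d), Function.iterate_add_apply]
      simp only [e]
      -- The sum telescopes to its two end terms, which agree because T^(p d) preserves Q.
      rw [Finset.sum_range_sub
        (fun k => ∫ ω, (Bb.comp f (hT.iterate (k * d))).1 ω ∂Q) p]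
      have hpd := (((mem_periods_iff hT h).1 hp).2 Q hQ).iterate d
      rw [← Function.iterate_mul] at hpd
      rw [hpd.integral_Bb, sub_eq_zero]
      simp [Bb.comp]
  · rintro ⟨hP, hd⟩
    have := hP.1
    refine ⟨this, fun f => ?_⟩
    have e : averageMeasure T d p P = P := by
      ext A hA
      refine averageMeasure_eq_of_forall hp.1 fun k => ?_
      have hk := hd.iterate k
      rw [← Function.iterate_mul, mul_comm] at hk
      rw [hk.map_eq]
    rw [← e]
    exact (averageMeasure_mem_dominated hT h hp d hP).2 f

/-- Averaged measures give the supremum formula, Θ^(d) ⊆ Θ gives continuity, and invariance holds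
because T commutes with its iterates. -/
theorem IsContinuousISE.component {hT : Measurable T} (hE : IsContinuousISE hT E)
    (hper : IsPeriodic hT E) (d : ℕ) : IsContinuousISE hT (component hT E d) := by
  obtain ⟨p, hp⟩ := hper
  have h := hE.sublinear
  have hsub : ∀ P ∈ dominated (SublinExp.component hT E d), P ∈ dominated E :=
    fun P hP => ((mem_dominated_component_iff hT hE hp).1 hP).1
  refine ⟨fun f => ⟨?_, fun b hb => ?_⟩, fun A hA hanti hempty => ?_, fun f => ?_⟩
  · rintro _ ⟨P, hP, rfl⟩
    exact hP.2 f
  · have hp0 : (0 : ℝ) < p := by exact_mod_cast hp.1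
    rw [component_eq_average hT h hp, average, one_div, inv_mul_le_iff₀ hp0]
    refine h.le_of_forall fun Q hQ => ?_
    have := hQ.1
    have hb' := hb ⟨_, averageMeasure_mem_dominated hT h hp d hQ, rfl⟩
    simp only at hb'
    rwa [integral_averageMeasure hT, one_div, inv_mul_le_iff₀ hp0] at hb'
  · exact tendsto_of_tendsto_of_tendsto_of_le_of_le tendsto_const_nhds
      (hE.continuous A hA hanti hempty) (fun _ => zero_le)
      fun n => biSup_mono (f := fun P : Measure Ω => P (A n)) hsub
  · rw [component_eq_average hT h hp, component_eq_average hT h hp, average, average,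
      ← hE.invariant (∑ k ∈ Finset.range p, Bb.comp f (hT.iterate (k * d)))]
    congr 2
    ext ω
    simp [Bb.comp, (Function.Commute.iterate_self T _).eq]

theorem mem_periods_component (hE : IsContinuousISE hT E) {p : ℕ} (hp : p ∈ periods hT E)
    (d : ℕ) : p ∈ periods hT (component hT E d) := by
  rw [mem_periods_iff hT (hE.component ⟨p, hp⟩ d).sublinear]
  exact ⟨hp.1, fun P hP => ((mem_periods_iff hT hE.sublinear).1 hp).2 P
    ((mem_dominated_component_iff hT hE hp).1 hP).1⟩

theorem self_mem_periods_component (hE : IsContinuousISE hT E) (hper : IsPeriodic hT E)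
    {d : ℕ} (hd : 0 < d) : d ∈ periods hT (component hT E d) := by
  rw [mem_periods_iff hT (hE.component hper d).sublinear]
  obtain ⟨p, hp⟩ := hper
  exact ⟨hd, fun P hP => ((mem_dominated_component_iff hT hE hp).1 hP).2⟩

/-- All of Θ is already `T^[p]`-invariant, and a sublinear expectation is determined by its
dominated set. -/
theorem component_period (hE : IsContinuousISE hT E) {p : ℕ} (hp : p ∈ periods hT E) :
    component hT E p = E := by
  funext f
  have e : dominated (component hT E p) = dominated E := by
    ext P
    rw [mem_dominated_component_iff hT hE hp, and_iff_left_iff_imp]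
    exact ((mem_periods_iff hT hE.sublinear).1 hp).2 P
  have := (hE.component ⟨p, hp⟩ p).sublinear f
  rw [e] at this
  exact this.unique (hE.sublinear f)

/-- Averaging a measure along T^d does not change its mass on a `T^[d]`-invariant set. -/
theorem upperProb_component (hE : IsContinuousISE hT E) (hper : IsPeriodic hT E) {d : ℕ}
    {A : Set Ω} (hA : MeasurableSet[MeasurableSpace.invariants T^[d]] A) :
    upperProb (component hT E d) A = upperProb E A := by
  obtain ⟨p, hp⟩ := hper
  refine le_antisymm (biSup_mono (f := fun P : Measure Ω => P A) fun P hP =>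
    ((mem_dominated_component_iff hT hE hp).1 hP).1) (iSup₂_le fun P hP => ?_)
  refine le_trans (le_of_eq ?_)
    (measure_le_upperProb (averageMeasure_mem_dominated hT hE.sublinear hp d hP) A)
  refine (averageMeasure_eq_of_forall hp.1 fun k => ?_).symm
  have := MeasurableSpace.le_invariants_iterate T^[d] k A hA
  rw [← Function.iterate_mul, mul_comm] at this
  rw [Measure.map_apply (hT.iterate _) this.1, this.2]

theorem invariants_iterate_le_of_dvd {a b : ℕ} (hab : a ∣ b) :
    MeasurableSpace.invariants T^[a] ≤ MeasurableSpace.invariants T^[b] := by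
  obtain ⟨c, rfl⟩ := hab
  rw [Function.iterate_mul]
  exact MeasurableSpace.le_invariants_iterate _ _

/-- The period of the component divides d, so `upperProb_component` applies to A; it also divides
the period of E, so the zero-one law of E applies to A. -/
theorem IsStronglyErgodic.component {hT : Measurable T} (hE : IsStronglyErgodic hT E) {d : ℕ}
    (hd : 0 < d) : IsStronglyErgodic hT (component hT E d) := by
  have hISE := hE.continuousISE
  have hsub := (hISE.component hE.periodic d).sublinear
  have hp := mem_periods_component hT hISE (period_mem hE.periodic) d
  refine ⟨hISE.component hE.periodic d, ⟨_, hp⟩, fun A hA => ?_⟩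
  rw [upperProb_component hT hISE hE.periodic (invariants_iterate_le_of_dvd
    (period_dvd hsub (self_mem_periods_component hT hISE hE.periodic hd)) A hA)]
  exact hE.trivial_on_invariants A (invariants_iterate_le_of_dvd (period_dvd hsub hp) A hA)

/-! ### Ergodic decomposition of `Θ` -/

open ProbabilityTheory

/-- Continuity of `E` rules out infinite descending chains of measurable sets all of whose increments
have upper probability one. -/
theorem IsContinuous.wellFounded (h : IsContinuous E) :
    WellFounded fun B A : {A : Set Ω // MeasurableSet A} =>
      B.1 ⊆ A.1 ∧ upperProb E (A.1 \ B.1) = 1 := by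
  rw [wellFounded_iff_isEmpty_descending_chain]
  refine ⟨fun ⟨A, hA⟩ => ?_⟩
  have hanti : Antitone fun n => (A n).1 := antitone_nat_of_succ_le fun n => (hA n).1
  -- These sets decrease to ∅, yet the n-th contains the increment A n \ A (n + 1), of upper
  -- probability one.
  have hlim := h (fun n => (A n).1 \ ⋂ k, (A k).1)
    (fun n => (A n).2.diff (.iInter fun k => (A k).2))
    (fun m n hmn => Set.sdiff_subset_sdiff_left (hanti hmn)) (by
      ext ω
      simp only [Set.mem_iInter, Set.mem_sdiff, Set.mem_empty_iff_false, iff_false]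
      exact fun hω => (hω 0).2 fun k => (hω k).1)
  refine absurd (ge_of_tendsto' hlim (b := 1) fun n => ?_) (by simp)
  rw [← (hA n).2]
  exact upperProb_mono (Set.sdiff_subset_sdiff_right (Set.iInter_subset _ _))

theorem ergodic_of_measure_eq_zero_or {S : Ω → Ω} {μ : Measure Ω} (hS : MeasurePreserving S μ μ)
    (h : ∀ B, MeasurableSet[MeasurableSpace.invariants S] B → μ B = 0 ∨ μ Bᶜ = 0) :
    Ergodic S μ := by
  refine ⟨hS, ⟨fun B hB hSB => ?_⟩⟩
  rw [eventuallyConst_set]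
  rcases h B ⟨hB, hSB⟩ with h | h
  · exact .inr (measure_eq_zero_iff_ae_notMem.1 h)
  · exact .inl (by simpa using measure_eq_zero_iff_ae_notMem.1 h)

theorem measurePreserving_cond {S : Ω → Ω} {P : Measure Ω} (hS : MeasurePreserving S P P)
    {A : Set Ω} (hA : MeasurableSet[MeasurableSpace.invariants S] A) :
    MeasurePreserving S P[|A] P[|A] := by
  have := hS.restrict_preimage hA.1
  rw [hA.2] at this
  exact this.smul_measure _

/-- `A` is an atom of the upper probability of `E` on the `S`-invariant σ-algebra. -/
def IsInvariantAtom (E : Bb Ω → ℝ) (S : Ω → Ω) (A : Set Ω) : Prop :=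
  MeasurableSet[MeasurableSpace.invariants S] A ∧
    ∀ B ⊆ A, MeasurableSet[MeasurableSpace.invariants S] B →
      upperProb E B = 0 ∨ upperProb E (A \ B) = 0

/-- The same alternative holds for all dominated P at once; this makes sums of conditional laws
ergodic. -/
theorem IsInvariantAtom.cond_eq_zero_or {S : Ω → Ω} {A : Set Ω} (hA : IsInvariantAtom E S A)
    {B : Set Ω} (hB : MeasurableSet[MeasurableSpace.invariants S] B) :
    (∀ P ∈ dominated E, P[|A] B = 0) ∨ (∀ P ∈ dominated E, P[|A] Bᶜ = 0) := by
  refine (hA.2 (A ∩ B) Set.inter_subset_left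
    (MeasurableSet.inter (m := MeasurableSpace.invariants S) hA.1 hB)).imp
      (fun h P hP => ?_) (fun h P hP => ?_)
  · rw [cond_apply hA.1.1, measure_eq_zero_of_upperProb hP h, mul_zero]
  · rw [Set.sdiff_self_inter] at h
    rw [cond_apply hA.1.1, ← Set.sdiff_eq, measure_eq_zero_of_upperProb hP h, mul_zero]

variable {S : Ω → Ω}

theorem IsInvariantAtom.ergodic_cond {A : Set Ω} (hA : IsInvariantAtom E S A)
    {P : Measure Ω} (hP : P ∈ dominated E) (hS : MeasurePreserving S P P) :
    Ergodic S P[|A] :=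
  ergodic_of_measure_eq_zero_or (measurePreserving_cond hS hA.1) fun _ hB =>
    (hA.cond_eq_zero_or hB).imp (fun h => h P hP) fun h => h P hP

/-- Dominated invariant probabilities agree after conditioning on an atom. -/
theorem IsInvariantAtom.cond_eq_cond {A : Set Ω} (hA : IsInvariantAtom E S A) {P Q : Measure Ω}
    (hP : P ∈ dominated E) (hPS : MeasurePreserving S P P) (hPA : P A ≠ 0)
    (hQ : Q ∈ dominated E) (hQS : MeasurePreserving S Q Q) (hQA : Q A ≠ 0) :
    P[|A] = Q[|A] := by
  have := hP.1
  have := hQ.1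
  have := cond_isProbabilityMeasure (μ := P) hPA
  have := cond_isProbabilityMeasure (μ := Q) hQA
  have hP' := measurePreserving_cond hPS hA.1
  have hQ' := measurePreserving_cond hQS hA.1
  have herg : Ergodic S (P[|A] + Q[|A]) := by
    refine ergodic_of_measure_eq_zero_or (hP'.add_measure hQ') fun B hB => ?_
    simp only [Measure.add_apply, add_eq_zero]
    exact (hA.cond_eq_zero_or hB).imp (fun h => ⟨h P hP, h Q hQ⟩) fun h => ⟨h P hP, h Q hQ⟩
  -- An invariant measure absolutely continuous with respect to an ergodic one is a multiple of it;
  -- the total mass 2 of the sum forces the factor 1/2.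
  have key : ∀ μ : Measure Ω, IsProbabilityMeasure μ → MeasurePreserving S μ μ →
      μ ≪ P[|A] + Q[|A] → μ = (2 : ℝ≥0∞)⁻¹ • (P[|A] + Q[|A]) := by
    intro μ _ hμ hac
    obtain ⟨c, hc⟩ := herg.eq_smul_of_absolutelyContinuous hμ hac
    have h1 : μ Set.univ = c * 2 := by
      conv_lhs => rw [hc]
      simp [mul_two]
    rw [measure_univ] at h1
    rw [← ENNReal.eq_inv_of_mul_eq_one_left h1.symm]
    exact hc
  rw [key P[|A] inferInstance hP' (Measure.AbsolutelyContinuous.rfl.add_right _)]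
  refine (key Q[|A] inferInstance hQ' ?_).symm
  rw [add_comm]
  exact Measure.AbsolutelyContinuous.rfl.add_right _

/-- If all dominated probabilities have the same conditional probability `μ` on a set of upper
probability one, then `μ` is dominated. -/
theorem mem_dominated_of_cond_eq {A : Set Ω} (hA : MeasurableSet A) (hV : upperProb E A = 1)
    {μ : Measure Ω} [IsProbabilityMeasure μ]
    (hμ : ∀ P ∈ dominated E, P A ≠ 0 → P[|A] = μ) : μ ∈ dominated E := by
  refine ⟨inferInstance, fun f => ?_⟩
  obtain ⟨C, hC⟩ := f.2.2
  have hm := Bb.abs_integral_le f hC μ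
  have hC0 : 0 ≤ C := (abs_nonneg _).trans hm
  set m := ∫ ω, f.1 ω ∂μ
  refine le_of_forall_pos_le_add fun ε hε => ?_
  -- P need only nearly attain the supremum: replacing μ by P costs at most 2C(1 - P(A)) ≤ ε. The
  -- denominator uses C + 1 because C may vanish.
  obtain ⟨P, hP, hPA⟩ : ∃ P ∈ dominated E, ENNReal.ofReal (1 - ε / (2 * (C + 1))) < P A := by
    have : ENNReal.ofReal (1 - ε / (2 * (C + 1))) < upperProb E A := by
      rw [hV, ENNReal.ofReal_lt_one]
      have : 0 < ε / (2 * (C + 1)) := by positivity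
      linarith
    simpa only [upperProb, lt_iSup_iff, exists_prop] using this
  have := hP.1
  have hδ : 1 - ε / (2 * (C + 1)) < P.real A := by
    rw [← ofReal_measureReal] at hPA
    exact lt_of_not_ge fun hle => hPA.not_ge (ENNReal.ofReal_le_ofReal hle)
  have h1 : ∫ ω in A, f.1 ω ∂P = P.real A * m := by
    have hne := (zero_le).trans_lt hPA
    rw [show m = ∫ ω, f.1 ω ∂(P[|A]) by rw [hμ P hP hne.ne'], ProbabilityTheory.cond,
      integral_smul_measure, smul_eq_mul, ENNReal.toReal_inv, ← mul_assoc, ← Measure.real,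
      mul_inv_cancel₀, one_mul]
    exact (ENNReal.toReal_pos hne.ne' (measure_ne_top _ _)).ne'
  have h2 : |∫ ω in Aᶜ, f.1 ω ∂P| ≤ C * (1 - P.real A) := by
    rw [← probReal_compl_eq_one_sub hA]
    have h : ∀ ω ∈ Aᶜ, ‖f.1 ω‖ ≤ C := fun ω _ => hC ω
    exact norm_setIntegral_le_of_norm_le_const (measure_lt_top _ _) h
  have h3 := integral_add_compl hA (Bb.integrable f P)
  have h4 := hP.2 f
  have h5 : 2 * C * (1 - P.real A) ≤ ε := by
    have hlt : (1 - P.real A) * (2 * (C + 1)) ≤ ε := by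
      rw [← le_div_iff₀ (by positivity)]
      linarith
    have : 0 ≤ 1 - P.real A := sub_nonneg.2 measureReal_le_one
    nlinarith
  have h6 : m * (1 - P.real A) ≤ C * (1 - P.real A) :=
    mul_le_mul_of_nonneg_right ((le_abs_self _).trans hm) (sub_nonneg.2 measureReal_le_one)
  have h7 := (abs_le.1 h2).1
  nlinarith

/-- Gives the inclusion of the hull of the ergodic measures in Θ. -/
theorem convex_dominated (E : Bb Ω → ℝ) : Convex ℝ≥0 (dominated E) := by
  intro P hP Q hQ a b _ _ hab
  have := hP.1
  have := hQ.1
  refine ⟨⟨?_⟩, fun f => ?_⟩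
  · simp only [Measure.add_apply, Measure.smul_apply, measure_univ]
    simp only [ENNReal.smul_def, smul_eq_mul, mul_one]
    exact_mod_cast hab
  · rw [integral_add_measure (Bb.integrable f _) (Bb.integrable f _), integral_smul_nnreal_measure,
      integral_smul_nnreal_measure]
    have hab' : (a : ℝ) + b = 1 := by exact_mod_cast hab
    simp only [NNReal.smul_def, smul_eq_mul]
    have h1 := mul_le_mul_of_nonneg_left (hP.2 f) a.coe_nonneg
    have h2 := mul_le_mul_of_nonneg_left (hQ.2 f) b.coe_nonneg
    calc _ ≤ a * E f + b * E f := add_le_add h1 h2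
      _ = E f := by rw [← add_mul, hab', one_mul]

/-- Conditioning on `A` is a convex combination of conditioning on `B` and on `A \ B`. -/
theorem cond_mem_of_convex {P : Measure Ω} [IsFiniteMeasure P] {A B : Set Ω}
    (hA : MeasurableSet A) (hB : MeasurableSet B) (hBA : B ⊆ A) {K : Set (Measure Ω)}
    (hK : Convex ℝ≥0 K) (hPA : P A ≠ 0) (h1 : P B ≠ 0 → P[|B] ∈ K)
    (h2 : P (A \ B) ≠ 0 → P[|A \ B] ∈ K) : P[|A] ∈ K := by
  have hsum : P B + P (A \ B) = P A := by
    rw [measure_add_sdiff hB.nullMeasurableSet, Set.union_eq_self_of_subset_left hBA]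
  have hres : P.restrict A = P.restrict B + P.restrict (A \ B) := by
    rw [← Measure.restrict_union Set.disjoint_sdiff_right (hA.diff hB),
      Set.union_sdiff_cancel hBA]
  -- Null pieces are treated apart, since membership in K is only known for pieces of positive mass;
  -- otherwise the weights are P(B)/P(A) and P(A \ B)/P(A).
  by_cases hB0 : P B = 0
  · rw [hB0, zero_add] at hsum
    rw [Measure.restrict_eq_zero.2 hB0, zero_add] at hres
    have e : P[|A] = P[|A \ B] := by
      rw [ProbabilityTheory.cond, ProbabilityTheory.cond, hres, hsum]
    rw [e]
    exact h2 (hsum ▸ hPA)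
  by_cases hAB0 : P (A \ B) = 0
  · rw [hAB0, add_zero] at hsum
    rw [Measure.restrict_eq_zero.2 hAB0, add_zero] at hres
    have e : P[|A] = P[|B] := by
      rw [ProbabilityTheory.cond, ProbabilityTheory.cond, hres, hsum]
    rw [e]
    exact h1 hB0
  have hfin : ∀ s : Set Ω, P s / P A ≠ ∞ := fun s =>
    ENNReal.div_ne_top (measure_ne_top _ _) hPA
  have e : P[|A] = (P B / P A).toNNReal • P[|B] + (P (A \ B) / P A).toNNReal • P[|A \ B] := by
    have hw : ∀ s : Set Ω, P s ≠ 0 →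
        (P s / P A).toNNReal • P[|s] = (P A)⁻¹ • P.restrict s := by
      intro s hs
      ext t _
      simp only [ProbabilityTheory.cond, Measure.smul_apply, ENNReal.smul_def, smul_eq_mul,
        ENNReal.coe_toNNReal (hfin s)]
      rw [← mul_assoc, ENNReal.div_eq_inv_mul, mul_assoc (P A)⁻¹,
        ENNReal.mul_inv_cancel hs (measure_ne_top _ _), mul_one]
    rw [hw B hB0, hw _ hAB0, ← smul_add, ← hres, ProbabilityTheory.cond]
  rw [e]
  refine hK (h1 hB0) (h2 hAB0) (zero_le) (zero_le) ?_
  rw [← ENNReal.toNNReal_add (hfin _) (hfin _), ← ENNReal.add_div, hsum,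
    ENNReal.div_self hPA (measure_ne_top _ _), ENNReal.toNNReal_one]

/-- If all dominated probabilities are `S`-invariant and the upper probability only takes the
values `0` and `1` on `S`-invariant sets, then the set of dominated probabilities is the convex
hull of finitely many ergodic ones. -/
theorem exists_finite_ergodic_convexHull (hcont : IsContinuous E)
    (hS : ∀ P ∈ dominated E, MeasurePreserving S P P)
    (h01 : ∀ A, MeasurableSet[MeasurableSpace.invariants S] A →
      upperProb E A = 0 ∨ upperProb E A = 1) :
    ∃ M : Set (Measure Ω), M.Finite ∧ (∀ μ ∈ M, IsProbabilityMeasure μ ∧ Ergodic S μ) ∧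
      dominated E = convexHull ℝ≥0 M := by
  have key : ∀ A : {A : Set Ω // MeasurableSet A},
      MeasurableSet[MeasurableSpace.invariants S] A.1 →
      ∃ M ⊆ dominated E, M.Finite ∧ (∀ μ ∈ M, Ergodic S μ) ∧
        ∀ P ∈ dominated E, P A.1 ≠ 0 → P[|A.1] ∈ convexHull ℝ≥0 M := by
    intro A
    induction A using hcont.wellFounded.induction with | _ A ih
    intro hA
    rcases h01 A.1 hA with hV | hV
    · exact ⟨∅, Set.empty_subset _, Set.finite_empty, by simp, fun P hP hPA =>
        absurd (measure_eq_zero_of_upperProb hP hV) hPA⟩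
    by_cases hat : IsInvariantAtom E S A.1
    · obtain ⟨P, hP, hPA⟩ : ∃ P ∈ dominated E, 0 < P A.1 := by
        have : 0 < upperProb E A.1 := hV ▸ one_pos
        simpa only [upperProb, lt_iSup_iff, exists_prop] using this
      have := hP.1
      have := cond_isProbabilityMeasure hPA.ne'
      have huniq : ∀ Q ∈ dominated E, Q A.1 ≠ 0 → Q[|A.1] = P[|A.1] := fun Q hQ hQA =>
        hat.cond_eq_cond hQ (hS Q hQ) hQA hP (hS P hP) hPA.ne'
      refine ⟨{P[|A.1]}, ?_, Set.finite_singleton _, ?_, fun Q hQ hQA => ?_⟩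
      · simpa using mem_dominated_of_cond_eq A.2 hV huniq
      · simpa using hat.ergodic_cond hP (hS P hP)
      · rw [huniq Q hQ hQA]
        exact subset_convexHull ℝ≥0 _ rfl
    · obtain ⟨B, hBA, hB, hVB, hVAB⟩ : ∃ B ⊆ A.1,
          MeasurableSet[MeasurableSpace.invariants S] B ∧
            upperProb E B ≠ 0 ∧ upperProb E (A.1 \ B) ≠ 0 := by
        simpa [IsInvariantAtom, hA] using hat
      have hAB : MeasurableSet[MeasurableSpace.invariants S] (A.1 \ B) :=
        MeasurableSet.diff (m := MeasurableSpace.invariants S) hA hB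
      have hVB := (h01 B hB).resolve_left hVB
      have hVAB := (h01 _ hAB).resolve_left hVAB
      -- Both pieces lie below A in the well-founded order: each is the increment left by the other,
      -- and both have upper probability one.
      obtain ⟨M₁, hM₁, hfin₁, herg₁, h₁⟩ := ih ⟨B, hB.1⟩ ⟨hBA, hVAB⟩ hB
      obtain ⟨M₂, hM₂, hfin₂, herg₂, h₂⟩ := ih ⟨A.1 \ B, hAB.1⟩
        ⟨Set.sdiff_subset, by rwa [Set.sdiff_sdiff_cancel_left hBA]⟩ hAB
      refine ⟨M₁ ∪ M₂, Set.union_subset hM₁ hM₂, hfin₁.union hfin₂,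
        fun μ hμ => hμ.elim (herg₁ μ) (herg₂ μ), fun P hP hPA => ?_⟩
      have := hP.1
      exact cond_mem_of_convex A.2 hB.1 hBA (convex_convexHull _ _) hPA
        (fun h => convexHull_mono Set.subset_union_left (h₁ P hP h))
        (fun h => convexHull_mono Set.subset_union_right (h₂ P hP h))
  -- Conditioning on the whole space changes nothing.
  obtain ⟨M, hM, hfin, herg, h⟩ := key ⟨Set.univ, .univ⟩
    (MeasurableSet.univ (m := MeasurableSpace.invariants S))
  refine ⟨M, hfin, fun μ hμ => ⟨(hM hμ).1, herg μ hμ⟩,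
    Set.Subset.antisymm (fun P hP => ?_) (convexHull_min hM (convex_dominated E))⟩
  have := hP.1
  simpa using h P hP (by simp)

end SublinExp

/-! ### The proposition. -/

theorem mainTheorem3 {Ω : Type*} [MeasurableSpace Ω] {T : Ω → Ω} (hT : Measurable T)
    (E : SublinExp.Bb Ω → ℝ) (hE : SublinExp.IsContinuousISE hT E)
    (hper : SublinExp.IsPeriodic hT E) :
    -- the components are well defined continuous invariant sublinear expectations with finite period
    (∀ d : ℕ, 0 < d →
      (∀ f : SublinExp.Bb Ω, Tendsto (SublinExp.average hT E d f) atTop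
        (𝓝 (SublinExp.component hT E d f))) ∧
      SublinExp.IsContinuousISE hT (SublinExp.component hT E d) ∧
      SublinExp.IsPeriodic hT (SublinExp.component hT E d)) ∧
    (SublinExp.IsStronglyErgodic hT E ↔
      ∀ d : ℕ, 0 < d → SublinExp.IsStronglyErgodic hT (SublinExp.component hT E d)) ∧
    (SublinExp.IsStronglyErgodic hT E →
      ∀ d : ℕ, 0 < d → ∃ S : Set (Measure Ω), S.Finite ∧
        (∀ P ∈ S, IsProbabilityMeasure P ∧
          Ergodic (T^[SublinExp.period hT (SublinExp.component hT E d)]) P) ∧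
        SublinExp.dominated (SublinExp.component hT E d) = convexHull ℝ≥0 S) := by
  refine ⟨fun d hd => ⟨fun f => ?_, hE.component hper d, ?_⟩, ⟨fun h d hd => h.component hd,
    fun h => ?_⟩, fun h d hd => ?_⟩
  · obtain ⟨p, hp⟩ := hper
    rw [SublinExp.component_eq_average hT hE.sublinear hp]
    exact SublinExp.tendsto_average hT hE.sublinear hp d f
  · exact ⟨d, SublinExp.self_mem_periods_component hT hE hper hd⟩
  · obtain ⟨p, hp⟩ := hper
    -- Taking d to be a period of E recovers E itself.
    exact SublinExp.component_period hT hE hp ▸ h p hp.1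
  · have hd' := h.component hd
    exact SublinExp.exists_finite_ergodic_convexHull hd'.continuousISE.continuous
      ((SublinExp.mem_periods_iff hT hd'.continuousISE.sublinear).1
        (SublinExp.period_mem hd'.periodic)).2 hd'.trivial_on_invariants
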